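/- Throughout, a *2-complex* is a CW complex with at most countably many cells, all of dimension at most $2$ (a graph is a 2-complex with no 2-cells); it is *infinite* if it has infinitely many cells and *finite* if it has finitely many. A 2-complex is *locally finite* if every 1-cell $e$ is attached to only finitely many 2-cells, i.e. for each 1-cell $e$ there are only finitely many 2-cells whose boundary (the image of the attaching map) meets the open cell $e$. **Lemma 2.3.** Let $P$ be a connected infinite 2-complex and let $P_0$ be a connected finite subcomplex of $P$. Then there is a connected locally finite 2-complex $P'$ that is homotopy equivalent to $P$ and contains $P_0$ as a subcomplex; that is, $P'$ has a subcomplex isomorphic to $P_0$ as a CW complex (by a homeomorphism that matches the cells and their characteristic maps). -/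

import Mathlib

open Topology

universe u

namespace TwoComplex

open Set Metric Topology.CWComplex

/-- A `2`-complex: a CW complex with at most countably many cells, all of dimension at most `2`.
(A graph counts as a `2`-complex with no `2`-cells.) -/
structure IsTwoComplex {X : Type*} [TopologicalSpace X] (C : Set X) [CWComplex C] : Prop where
  isEmpty_cell : ∀ n : ℕ, 2 < n → IsEmpty (cell C n)
  countable_cell : ∀ n : ℕ, Countable (cell C n)

/-- A CW complex is infinite if it has infinitely many cells (of all dimensions together). -/
def HasInfinitelyManyCells {X : Type*} [TopologicalSpace X] (C : Set X) [CWComplex C] : Prop :=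
  Infinite (Σ n : ℕ, cell C n)

/-- Every `1`-cell is attached to only finitely many `2`-cells: the boundary (the image of the
attaching map) of all but finitely many `2`-cells is disjoint from the given open `1`-cell. -/
def LocallyFiniteTwoComplex {X : Type*} [TopologicalSpace X] (C : Set X) [CWComplex C] : Prop :=
  ∀ e : cell C 1, {f : cell C 2 | (cellFrontier 2 f ∩ openCell 1 e).Nonempty}.Finite

/-- An isomorphism of CW complexes: a homeomorphism together with dimension-preserving bijections
of the cells, carrying every characteristic map (on the closed ball) to the characteristic map of
the corresponding cell. -/
structure CWIso {X Y : Type*} [TopologicalSpace X] [TopologicalSpace Y]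
    (C : Set X) (D : Set Y) [CWComplex C] [CWComplex D] where
  toHomeomorph : C ≃ₜ D
  cellEquiv : ∀ n : ℕ, cell C n ≃ cell D n
  apply_map : ∀ (n : ℕ) (i : cell C n) (x : Fin n → ℝ), x ∈ closedBall 0 1 →
    ∀ p : C, (p : X) = map n i x → (toHomeomorph p : Y) = map n (cellEquiv n i) x

end TwoComplex

namespace TwoComplex

open Set Metric Topology.CWComplex

/-! ### Products of a CW complex with a locally compact space. -/

section WeakTopology

variable {X : Type*} [TopologicalSpace X] [CWComplex (univ : Set X)]

/-! The complex `P'` is a telescope inside the cylinder `X × ℝ`, cellulated by the integer heights.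
Give each 1-cell `e` and each 2-cell `f` an integer level `ν`, and keep all of `v × ℝ` over a vertex
`v`, `e × [ν e, ∞)` over a 1-cell, and only `f × {ν f}` over a 2-cell. This is a subcomplex as soon
as `ν e ≤ ν f` whenever `f` meets `e`, and it has dimension at most 2.

The cylinder is homotopy equivalent to `X` and deformation retracts onto the telescope in two
collapses: first `f × ℝ` is pushed radially onto `f × {ν f}` and the walls over the frontier of `f`,
then `e × ℝ` onto `e × [ν e, ∞)` and the lines over its endpoints. The second collapse fixes the
2-cells because they sit above the levels of their edges. `IsCollapse.exists_homotopyEquiv` treats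
both at once; continuity is checked cell by cell with `continuousOn_of_continuousOn_cells`.

If only finitely many 1-cells have level at most `k` and only finitely many 2-cells have level
exactly `k`, the telescope is locally finite (`locallyFinite_telescope`). Countability of the cells
yields such levels, with level 0 on the finite `P₀` (`exists_levels`), so `P₀ × {0}` is a copy of
`P₀` in the telescope. -/

lemma continuousOn_map_prod (K : Type*) [TopologicalSpace K] {n : ℕ}
    (i : cell (univ : Set X) n) :
    ContinuousOn (fun p : (Fin n → ℝ) × K ↦ (map n i p.1, p.2)) (closedBall 0 1 ×ˢ univ) :=
  ((continuousOn n i).comp continuousOn_fst (fun _ hp ↦ hp.1)).prodMk continuousOn_snd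

lemma isClosed_preimage_map_prod {K : Type*} [TopologicalSpace K] {n : ℕ}
    (i : cell (univ : Set X) n) {B : Set (X × K)} (hB : IsClosed B) :
    IsClosed {p : (Fin n → ℝ) × K | p.1 ∈ closedBall 0 1 ∧ (map n i p.1, p.2) ∈ B} := by
  convert (continuousOn_map_prod K i).preimage_isClosed_of_isClosed
    (isClosed_closedBall.prod isClosed_univ) hB using 1
  ext p; simp

variable [T2Space X]

/-- The product of a CW complex with a locally compact space carries the weak topology with respect
to the products of the closed cells with the whole space. -/
lemma isClosed_of_isClosed_inter_closedCell_prod {K : Type*} [TopologicalSpace K]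
    [LocallyCompactSpace K] {A : Set (X × K)}
    (hA : ∀ n (i : cell (univ : Set X) n), IsClosed (A ∩ closedCell n i ×ˢ (univ : Set K))) :
    IsClosed A := by
  rw [← isOpen_compl_iff, isOpen_iff_mem_nhds]
  rintro ⟨x, k⟩ hxk
  have hx : x ∈ (univ : Set X) := mem_univ x
  rw [← CWComplex.union (C := (univ : Set X))] at hx
  obtain ⟨n, i, hxi⟩ : ∃ n, ∃ i : cell (univ : Set X) n, x ∈ closedCell n i := by simpa using hx
  have hslice : IsOpen {l : K | (x, l) ∉ A} := by
    have : {l : K | (x, l) ∉ A} =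
        ((fun l : K ↦ (x, l)) ⁻¹' (A ∩ closedCell n i ×ˢ (univ : Set K)))ᶜ := by
      ext l; simp [hxi]
    rw [this, isOpen_compl_iff]
    exact (hA n i).preimage (by fun_prop)
  -- Tube argument: `L` is compact, so projection along `L` is closed, and the points `y` for which
  -- `A` meets `{y} × L` form a set closed in every cell, hence closed in `X`.
  obtain ⟨L, hL, hLA, hLc⟩ := local_compact_nhds (hslice.mem_nhds hxk)
  have hV : IsClosed {y : X | ∃ l ∈ L, (y, l) ∈ A} := by
    rw [CWComplex.closed (univ : Set X) _ (subset_univ _)]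
    intro m j
    have : {y : X | ∃ l ∈ L, (y, l) ∈ A} ∩ closedCell m j = Prod.fst ''
        ((fun p : X × L ↦ (p.1, (p.2 : K))) ⁻¹' (A ∩ closedCell m j ×ˢ (univ : Set K))) := by
      ext y; simp
    rw [this]
    have : CompactSpace L := isCompact_iff_compactSpace.1 hLc
    exact isClosedMap_fst_of_compactSpace _ ((hA m j).preimage (by fun_prop))
  have hxV : x ∈ {y : X | ∃ l ∈ L, (y, l) ∈ A}ᶜ := by
    rintro ⟨l, hl, hlA⟩
    exact hLA hl hlA
  filter_upwards [prod_mem_nhds (hV.isOpen_compl.mem_nhds hxV) hL]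
  rintro ⟨y, l⟩ ⟨hy, hl⟩ hyl
  exact hy ⟨l, hl, hyl⟩

/-- A characteristic map goes from a compact ball to a Hausdorff space, so it is proper; its product
with the identity of `K` is then a closed map. -/
lemma isClosed_inter_closedCell_prod {K : Type*} [TopologicalSpace K] {A : Set (X × K)} {n : ℕ}
    (i : cell (univ : Set X) n)
    (hA : IsClosed {p : (Fin n → ℝ) × K | p.1 ∈ closedBall 0 1 ∧ (map n i p.1, p.2) ∈ A}) :
    IsClosed (A ∩ closedCell n i ×ˢ (univ : Set K)) := by
  let g : closedBall (0 : Fin n → ℝ) 1 → X := fun b ↦ map n i b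
  have hg : Continuous g := continuousOn_iff_continuous_domRestrict.1 (continuousOn n i)
  have hcpt : CompactSpace (closedBall (0 : Fin n → ℝ) 1) :=
    isCompact_iff_compactSpace.1 (isCompact_closedBall _ _)
  have hprop : IsProperMap (Prod.map g (id : K → K)) := hg.isProperMap.prodMap isProperMap_id
  have : A ∩ closedCell n i ×ˢ (univ : Set K) = Prod.map g id ''
      ((fun p : closedBall (0 : Fin n → ℝ) 1 × K ↦ ((p.1 : Fin n → ℝ), p.2)) ⁻¹'
        {p : (Fin n → ℝ) × K | p.1 ∈ closedBall 0 1 ∧ (map n i p.1, p.2) ∈ A}) := by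
    ext ⟨x, k⟩
    constructor
    · rintro ⟨hxk, ⟨b, hb, rfl⟩, -⟩
      exact ⟨(⟨b, hb⟩, k), ⟨hb, hxk⟩, rfl⟩
    · rintro ⟨⟨b, l⟩, ⟨hb, hbl⟩, h⟩
      simp only [Prod.map_apply, id_eq, Prod.mk.injEq] at h
      obtain ⟨rfl, rfl⟩ := h
      exact ⟨hbl, ⟨b, hb, rfl⟩, mem_univ _⟩
  rw [this]
  exact hprop.isClosedMap _ (hA.preimage (by fun_prop))

/-- Continuity on a closed subset of the product of a CW complex with a locally compact space can
be checked on the cells, assuming continuity over the frontier of the cell. -/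
lemma continuousOn_of_continuousOn_cells {K W : Type*} [TopologicalSpace K]
    [LocallyCompactSpace K] [TopologicalSpace W] {S : Set (X × K)} (hS : IsClosed S)
    {g : X × K → W}
    (hg : ∀ n (i : cell (univ : Set X) n),
      ContinuousOn (fun p : (Fin n → ℝ) × K ↦ g (map n i p.1, p.2))
        {p | p.1 ∈ sphere 0 1 ∧ (map n i p.1, p.2) ∈ S} →
      ContinuousOn (fun p : (Fin n → ℝ) × K ↦ g (map n i p.1, p.2))
        {p | p.1 ∈ closedBall 0 1 ∧ (map n i p.1, p.2) ∈ S}) :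
    ContinuousOn g S := by
  have key : ∀ n (i : cell (univ : Set X) n) (B : Set W), IsClosed B →
      IsClosed ((S ∩ g ⁻¹' B) ∩ closedCell n i ×ˢ (univ : Set K)) := by
    intro n
    induction n using Nat.strong_induction_on with
    | _ n ih =>
    intro i B hB
    -- The frontier lies in finitely many closed cells of lower dimension, so the induction
    -- hypothesis gives continuity over it.
    obtain ⟨I, hI⟩ := CWComplex.cellFrontier_subset_finite_closedCell n i
    have hfr : ContinuousOn g (S ∩ cellFrontier n i ×ˢ (univ : Set K)) := by
      rw [continuousOn_iff_isClosed]
      intro B hB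
      refine ⟨⋃ m ∈ Finset.range n, ⋃ j ∈ I m, (S ∩ g ⁻¹' B) ∩ closedCell m j ×ˢ (univ : Set K),
        isClosed_biUnion_finset fun m hm ↦ isClosed_biUnion_finset fun j _ ↦
          ih m (Finset.mem_range.1 hm) j B hB, ?_⟩
      ext ⟨x, k⟩
      constructor
      · rintro ⟨hB, hxS, hx, -⟩
        refine ⟨?_, hxS, hx, mem_univ _⟩
        have := hI hx
        simp only [mem_iUnion] at this ⊢
        obtain ⟨m, hm, j, hj, hxj⟩ := this
        exact ⟨m, Finset.mem_range.2 hm, j, hj, ⟨hxS, hB⟩, hxj, mem_univ _⟩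
      · rintro ⟨h, h'⟩
        simp only [mem_iUnion] at h
        obtain ⟨m, hm, j, hj, ⟨-, hB⟩, -⟩ := h
        exact ⟨hB, h'⟩
    have h2 := hg n i (hfr.comp ((continuousOn_map_prod K i).mono fun p hp ↦
      ⟨sphere_subset_closedBall hp.1, mem_univ _⟩)
      fun p hp ↦ ⟨hp.2, ⟨p.1, hp.1, rfl⟩, mem_univ _⟩)
    refine isClosed_inter_closedCell_prod i ?_
    convert h2.preimage_isClosed_of_isClosed (isClosed_preimage_map_prod i hS) hB using 1
    ext p; simp [and_assoc]
  rw [continuousOn_iff_isClosed]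
  intro B hB
  refine ⟨S ∩ g ⁻¹' B, isClosed_of_isClosed_inter_closedCell_prod fun n i ↦ key n i B hB, ?_⟩
  ext p; simp; tauto

end WeakTopology

/-! ### The radial retraction of a solid cylinder. -/

section RadialRetraction

variable {E : Type*} [NormedAddCommGroup E] [NormedSpace ℝ E]

/-- For an idempotent `π : ℝ → ℝ`, the radial retraction of the cylinder `closedBall 0 1 × ℝ` onto
the union of `closedBall 0 1 × range π` and `sphere 0 1 × ℝ`. -/
noncomputable def radialRetraction (π : ℝ → ℝ) (p : E × ℝ) : E × ℝ :=
  -- With `h = |t - π t|` and `m = max 1 (‖b‖ (1 + h))`, the point `b` is scaled by `(1 + h) / m`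
  -- and `t` is clamped to distance `m - 1` from `π t`. If `‖b‖ = 1` then `m - 1 = h`, and if `h =
  -- 0` and `‖b‖ ≤ 1` then `m = 1`; nothing moves in either case.
  (((1 + |p.2 - π p.2|) / max 1 (‖p.1‖ * (1 + |p.2 - π p.2|))) • p.1,
    max (min p.2 (π p.2 + (max 1 (‖p.1‖ * (1 + |p.2 - π p.2|)) - 1)))
      (π p.2 - (max 1 (‖p.1‖ * (1 + |p.2 - π p.2|)) - 1)))

variable {π : ℝ → ℝ}

lemma continuous_radialRetraction (hπ : Continuous π) :
    Continuous (radialRetraction π : E × ℝ → E × ℝ) := by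
  unfold radialRetraction
  have : ∀ p : E × ℝ, max 1 (‖p.1‖ * (1 + |p.2 - π p.2|)) ≠ 0 := fun p ↦
    (lt_of_lt_of_le one_pos (le_max_left _ _)).ne'
  fun_prop (disch := assumption)

lemma radialRetraction_of_norm_eq_one {p : E × ℝ} (hp : ‖p.1‖ = 1) :
    radialRetraction π p = p := by
  have h : max 1 (‖p.1‖ * (1 + |p.2 - π p.2|)) = 1 + |p.2 - π p.2| := by
    rw [hp, one_mul, max_eq_right]; linarith [abs_nonneg (p.2 - π p.2)]
  have h' : (1 + |p.2 - π p.2|) ≠ 0 := by positivity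
  unfold radialRetraction
  rw [h, div_self h', one_smul]
  ext
  · rfl
  · simp only [add_sub_cancel_left]
    rw [min_eq_left (by linarith [le_abs_self (p.2 - π p.2)]),
      max_eq_left (by linarith [neg_abs_le (p.2 - π p.2)])]

lemma radialRetraction_of_fixed {p : E × ℝ} (hn : ‖p.1‖ ≤ 1) (hp : π p.2 = p.2) :
    radialRetraction π p = p := by
  unfold radialRetraction
  simp [hp, hn]

lemma norm_radialRetraction_le (p : E × ℝ) : ‖(radialRetraction π p).1‖ ≤ 1 := by
  have h : 0 < max 1 (‖p.1‖ * (1 + |p.2 - π p.2|)) := lt_of_lt_of_le one_pos (le_max_left _ _)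
  simp only [radialRetraction, norm_smul, norm_div, Real.norm_eq_abs, abs_of_pos h]
  rw [abs_of_pos (by positivity), div_mul_eq_mul_div, div_le_one h, mul_comm]
  exact le_max_right _ _

/-- The two cases are the two values of the maximum: at value 1 the height is clamped to `π p.2`,
otherwise the ball coordinate is normalized. -/
lemma radialRetraction_mem (p : E × ℝ) :
    ‖(radialRetraction π p).1‖ = 1 ∨ (radialRetraction π p).2 = π p.2 := by
  rcases le_total (‖p.1‖ * (1 + |p.2 - π p.2|)) 1 with h | h
  · right
    simp [radialRetraction, max_eq_left h]
  · left
    have h0 : 0 < ‖p.1‖ * (1 + |p.2 - π p.2|) := lt_of_lt_of_le one_pos h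
    simp only [radialRetraction, norm_smul, norm_div, Real.norm_eq_abs, max_eq_right h,
      abs_of_pos h0]
    rw [abs_of_pos (by positivity), div_mul_eq_mul_div, mul_comm, div_self h0.ne']

/-- The straight line homotopy from the identity to the radial retraction. -/
noncomputable def radialHomotopy (π : ℝ → ℝ) (p : E × ℝ) (s : ℝ) : E × ℝ :=
  p + s • (radialRetraction π p - p)

lemma continuous_radialHomotopy (hπ : Continuous π) :
    Continuous fun q : E × ℝ × ℝ ↦ radialHomotopy π (q.1, q.2.1) q.2.2 := by
  have := continuous_radialRetraction (E := E) hπ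
  unfold radialHomotopy
  fun_prop

lemma radialHomotopy_zero (p : E × ℝ) : radialHomotopy π p 0 = p := by simp [radialHomotopy]

lemma radialHomotopy_one (p : E × ℝ) : radialHomotopy π p 1 = radialRetraction π p := by
  simp [radialHomotopy]

lemma radialHomotopy_of_norm_eq_one {p : E × ℝ} (hp : ‖p.1‖ = 1) (s : ℝ) :
    radialHomotopy π p s = p := by
  simp [radialHomotopy, radialRetraction_of_norm_eq_one hp]

lemma radialHomotopy_of_fixed {p : E × ℝ} (hn : ‖p.1‖ ≤ 1) (hp : π p.2 = p.2) (s : ℝ) :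
    radialHomotopy π p s = p := by
  simp [radialHomotopy, radialRetraction_of_fixed hn hp]

lemma radialHomotopy_mem_closedBall {p : E × ℝ} (hn : p.1 ∈ closedBall 0 1) {s : ℝ}
    (hs : s ∈ Icc (0 : ℝ) 1) : (radialHomotopy π p s).1 ∈ closedBall 0 1 :=
  (convex_closedBall (0 : E) 1).add_smul_sub_mem hn
    (mem_closedBall_zero_iff.2 (norm_radialRetraction_le p)) hs

end RadialRetraction

/-! ### Layered subsets of the cylinder and their collapses. -/

section Layers

variable {X : Type*} [TopologicalSpace X] [CWComplex (univ : Set X)]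

lemma sigma_eq_of_mem_openCell {n m : ℕ} {i : cell (univ : Set X) n} {j : cell (univ : Set X) m}
    {x : X} (hi : x ∈ openCell n i) (hj : x ∈ openCell m j) :
    (⟨n, i⟩ : Σ n, cell (univ : Set X) n) = ⟨m, j⟩ :=
  CWComplex.eq_of_not_disjoint_openCell (not_disjoint_iff.2 ⟨x, hi, hj⟩)

lemma exists_mem_openCell (x : X) : ∃ n, ∃ i : cell (univ : Set X) n, x ∈ openCell n i := by
  have hx := mem_univ x
  rw [← CWComplex.iUnion_openCell_eq_complex (C := (univ : Set X))] at hx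
  simpa using hx

lemma exists_mem_openCell_of_mem_cellFrontier {n : ℕ} {i : cell (univ : Set X) n} {x : X}
    [T2Space X] (hx : x ∈ cellFrontier n i) :
    ∃ m < n, ∃ j : cell (univ : Set X) m, x ∈ openCell m j := by
  obtain ⟨I, hI⟩ := CWComplex.cellFrontier_subset_finite_openCell n i
  have := hI hx
  simp only [mem_iUnion] at this
  obtain ⟨m, hm, j, -, hj⟩ := this
  exact ⟨m, hm, j, hj⟩

/-- The part of the cylinder `X × ℝ` which over each open cell consists of the given heights. -/
def layered (κ : ∀ n, cell (univ : Set X) n → Set ℝ) : Set (X × ℝ) :=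
  {p | ∃ n, ∃ i : cell (univ : Set X) n, p.1 ∈ openCell n i ∧ p.2 ∈ κ n i}

/-- A choice of heights is face monotone if it can only grow when passing to cells that meet the
closure of a given one. -/
def FaceMonotone (κ : ∀ n, cell (univ : Set X) n → Set ℝ) : Prop :=
  ∀ ⦃n⦄ (i : cell (univ : Set X) n) ⦃m⦄ (j : cell (univ : Set X) m) ⦃x : X⦄,
    x ∈ closedCell n i → x ∈ openCell m j → κ n i ⊆ κ m j

variable {κ κ' : ∀ n, cell (univ : Set X) n → Set ℝ}

lemma mem_layered_iff {n : ℕ} {i : cell (univ : Set X) n} {x : X} (hx : x ∈ openCell n i) {t : ℝ} :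
    (x, t) ∈ layered κ ↔ t ∈ κ n i := by
  constructor
  · rintro ⟨m, j, hj, ht⟩
    cases sigma_eq_of_mem_openCell hx hj
    exact ht
  · exact fun h ↦ ⟨n, i, hx, h⟩

lemma FaceMonotone.mem_layered (hκ : FaceMonotone κ) {n : ℕ} {i : cell (univ : Set X) n} {x : X}
    (hx : x ∈ closedCell n i) {t : ℝ} (ht : t ∈ κ n i) : (x, t) ∈ layered κ := by
  obtain ⟨m, j, hj⟩ := exists_mem_openCell x
  exact ⟨m, j, hj, hκ i j hx hj ht⟩

lemma layered_univ : layered (X := X) (fun _ _ ↦ univ) = univ := by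
  ext ⟨x, t⟩
  obtain ⟨m, j, hj⟩ := exists_mem_openCell x
  simp [mem_layered_iff hj]

open Classical in
/-- The homotopy of the cylinder `X × ℝ` which is the radial homotopy over the open `d`-cells and
stationary over all other cells. -/
noncomputable def layerHomotopy (d : ℕ) (π : cell (univ : Set X) d → ℝ → ℝ) (p : X × ℝ × ℝ) :
    X × ℝ :=
  if h : ∃ i : cell (univ : Set X) d, p.1 ∈ openCell d i then
    (map d h.choose (radialHomotopy (π h.choose) ((map d h.choose).symm p.1, p.2.1) p.2.2).1,
      (radialHomotopy (π h.choose) ((map d h.choose).symm p.1, p.2.1) p.2.2).2)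
  else (p.1, p.2.1)

variable {d : ℕ} {π : cell (univ : Set X) d → ℝ → ℝ}

lemma layerHomotopy_of_ne {n : ℕ} (hn : n ≠ d) {i : cell (univ : Set X) n} {x : X}
    (hx : x ∈ openCell n i) (t s : ℝ) : layerHomotopy d π (x, t, s) = (x, t) := by
  rw [layerHomotopy, dif_neg]
  rintro ⟨j, hj⟩
  cases sigma_eq_of_mem_openCell hx hj
  exact hn rfl

/-- The definition uses this formula only over the open cell. It persists on the sphere because the
radial homotopy is stationary there, while the image lies in cells of lower dimension, where the
layer homotopy is stationary too. -/
lemma layerHomotopy_map [T2Space X] (i : cell (univ : Set X) d) {b : Fin d → ℝ}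
    (hb : b ∈ closedBall 0 1) (t s : ℝ) :
    layerHomotopy d π (map d i b, t, s) =
      (map d i (radialHomotopy (π i) (b, t) s).1, (radialHomotopy (π i) (b, t) s).2) := by
  rw [← sphere_union_ball] at hb
  rcases hb with hb | hb
  · obtain ⟨m, hm, j, hj⟩ := exists_mem_openCell_of_mem_cellFrontier
      (show map d i b ∈ cellFrontier d i from ⟨b, hb, rfl⟩)
    rw [layerHomotopy_of_ne hm.ne hj, radialHomotopy_of_norm_eq_one (by simpa using hb)]
  · have hx : map d i b ∈ openCell d i := ⟨b, hb, rfl⟩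
    have h : ∃ i' : cell (univ : Set X) d, map d i b ∈ openCell d i' := ⟨i, hx⟩
    have hi : h.choose = i := by
      simpa using (sigma_eq_of_mem_openCell hx h.choose_spec).symm
    rw [layerHomotopy, dif_pos h]
    simp only [hi]
    rw [(map d i).left_inv (by rwa [source_eq])]

lemma layerHomotopy_zero [T2Space X] (x : X) (t : ℝ) : layerHomotopy d π (x, t, 0) = (x, t) := by
  obtain ⟨n, i, hx⟩ := exists_mem_openCell x
  by_cases hn : n = d
  · subst hn
    obtain ⟨b, hb, rfl⟩ := hx
    rw [layerHomotopy_map i (ball_subset_closedBall hb), radialHomotopy_zero]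
  · exact layerHomotopy_of_ne hn hx _ _

/-- `κ'` arises from `κ` by restricting the heights over the `d`-cells from `ℝ` to the ranges of
the retractions `π`. -/
structure IsCollapse (κ κ' : ∀ n, cell (univ : Set X) n → Set ℝ) (d : ℕ)
    (π : cell (univ : Set X) d → ℝ → ℝ) : Prop where
  isClosed : IsClosed (layered κ)
  mono : FaceMonotone κ
  mono' : FaceMonotone κ'
  eq_of_ne : ∀ n ≠ d, ∀ i, κ' n i = κ n i
  eq_univ : ∀ i, κ d i = univ
  eq_range : ∀ i, κ' d i = range (π i)
  idem : ∀ i t, π i (π i t) = π i t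
  continuous : ∀ i, Continuous (π i)
  isClosed' : ∀ n i, IsClosed (κ' n i)

namespace IsCollapse

lemma subset (h : IsCollapse κ κ' d π) : layered κ' ⊆ layered κ := by
  rintro ⟨x, t⟩ ⟨n, i, hx, ht⟩
  refine ⟨n, i, hx, ?_⟩
  by_cases hn : n = d
  · subst hn
    simp [h.eq_univ]
  · rwa [← h.eq_of_ne n hn]

lemma layerHomotopy_of_mem [T2Space X] (h : IsCollapse κ κ' d π) {x : X} {t : ℝ}
    (hx : (x, t) ∈ layered κ') (s : ℝ) : layerHomotopy d π (x, t, s) = (x, t) := by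
  obtain ⟨n, i, hx, ht⟩ := hx
  by_cases hn : n = d
  · subst hn
    obtain ⟨b, hb, rfl⟩ := hx
    rw [h.eq_range] at ht
    obtain ⟨t, rfl⟩ := ht
    rw [layerHomotopy_map i (ball_subset_closedBall hb),
      radialHomotopy_of_fixed (by simpa using ball_subset_closedBall hb) (h.idem i t)]
  · exact layerHomotopy_of_ne hn hx _ _

lemma layerHomotopy_mem [T2Space X] (h : IsCollapse κ κ' d π) {x : X} {t s : ℝ}
    (hx : (x, t) ∈ layered κ) (hs : s ∈ Icc (0 : ℝ) 1) :
    layerHomotopy d π (x, t, s) ∈ layered κ := by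
  obtain ⟨n, i, hx', ht⟩ := hx
  by_cases hn : n = d
  · subst hn
    obtain ⟨b, hb, rfl⟩ := hx'
    rw [layerHomotopy_map i (ball_subset_closedBall hb)]
    exact h.mono.mem_layered (i := i)
      ⟨_, radialHomotopy_mem_closedBall (ball_subset_closedBall hb) hs, rfl⟩ (by simp [h.eq_univ])
  · rw [layerHomotopy_of_ne hn hx']
    exact ⟨n, i, hx', ht⟩

/-- Over a `d`-cell the retraction ends either on the wall, over lower cells that carry all heights
by monotonicity, or at a height in the range of `π`. -/
lemma layerHomotopy_one_mem [T2Space X] (h : IsCollapse κ κ' d π) {x : X} {t : ℝ}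
    (hx : (x, t) ∈ layered κ) : layerHomotopy d π (x, t, 1) ∈ layered κ' := by
  obtain ⟨n, i, hx', ht⟩ := hx
  by_cases hn : n = d
  · subst hn
    obtain ⟨b, hb, rfl⟩ := hx'
    rw [layerHomotopy_map i (ball_subset_closedBall hb), radialHomotopy_one]
    rcases radialRetraction_mem (π := π i) (b, t) with h1 | h1
    · have hfr : map n i (radialRetraction (π i) (b, t)).1 ∈ cellFrontier n i :=
        ⟨_, by simpa using h1, rfl⟩
      obtain ⟨m, hm, j, hj⟩ := exists_mem_openCell_of_mem_cellFrontier hfr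
      refine ⟨m, j, hj, ?_⟩
      rw [h.eq_of_ne m hm.ne]
      refine h.mono i j (cellFrontier_subset_closedCell _ _ hfr) hj ?_
      simp [h.eq_univ]
    · refine h.mono'.mem_layered (i := i)
        ⟨_, mem_closedBall_zero_iff.2 (norm_radialRetraction_le (b, t)), rfl⟩ ?_
      rw [h1, h.eq_range]
      exact mem_range_self t
  · rw [layerHomotopy_of_ne hn hx']
    exact ⟨n, i, hx', by rwa [h.eq_of_ne n hn]⟩

/-- Below dimension `d` the homotopy is stationary, and in dimension `d` it is the radial formula.
Above `d`, the heights of the open cell are already those of `κ'`, so the homotopy is stationary on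
a closed product, which is glued to the closed part over the frontier. -/
lemma continuousOn_layerHomotopy [T2Space X] (h : IsCollapse κ κ' d π) :
    ContinuousOn (layerHomotopy d π)
      {p : X × ℝ × ℝ | (p.1, p.2.1) ∈ layered κ ∧ p.2.2 ∈ Icc (0 : ℝ) 1} := by
  have hS : IsClosed {p : X × ℝ × ℝ | (p.1, p.2.1) ∈ layered κ ∧ p.2.2 ∈ Icc (0 : ℝ) 1} :=
    (h.isClosed.preimage (by fun_prop)).inter (isClosed_Icc.preimage (by fun_prop))
  refine continuousOn_of_continuousOn_cells hS fun n i hfr ↦ ?_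
  have hproj : ContinuousOn (fun p : (Fin n → ℝ) × ℝ × ℝ ↦ (map n i p.1, p.2.1))
      (closedBall 0 1 ×ˢ univ) :=
    ((continuousOn n i).comp continuousOn_fst (fun _ hp ↦ hp.1)).prodMk (by fun_prop)
  rcases lt_trichotomy n d with hn | rfl | hn
  · refine (hproj.mono fun p hp ↦ ⟨hp.1, mem_univ _⟩).congr fun p hp ↦ ?_
    obtain ⟨m, j, hj⟩ := exists_mem_openCell (map n i p.1)
    have hm : m ≤ n := by
      by_contra! hmn
      have hdisj := CWComplex.disjoint_skeleton_openCell (C := (univ : Set X)) (n := n) (m := m)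
        (j := j) (by exact_mod_cast hmn)
      exact disjoint_left.1 hdisj (CWComplex.closedCell_subset_skeleton n i ⟨_, hp.1, rfl⟩) hj
    exact layerHomotopy_of_ne (hm.trans_lt hn).ne hj _ _
  · have hcont : ContinuousOn (fun p : (Fin n → ℝ) × ℝ × ℝ ↦
        (map n i (radialHomotopy (π i) (p.1, p.2.1) p.2.2).1,
          (radialHomotopy (π i) (p.1, p.2.1) p.2.2).2))
        (closedBall 0 1 ×ˢ univ ×ˢ Icc (0 : ℝ) 1) := by
      have hr := continuous_radialHomotopy (E := Fin n → ℝ) (h.continuous i)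
      exact ((continuousOn n i).comp (continuous_fst.comp hr).continuousOn fun p hp ↦
        radialHomotopy_mem_closedBall hp.1 hp.2.2).prodMk (continuous_snd.comp hr).continuousOn
    refine (hcont.mono fun p hp ↦ ⟨hp.1, mem_univ _, hp.2.2⟩).congr fun p hp ↦ ?_
    exact layerHomotopy_map i hp.1 _ _
  · have hcyl : ContinuousOn (fun p : (Fin n → ℝ) × ℝ × ℝ ↦ layerHomotopy d π (map n i p.1, p.2))
        (closedBall 0 1 ×ˢ κ' n i ×ˢ univ) := by
      refine (hproj.mono fun p hp ↦ ⟨hp.1, mem_univ _⟩).congr fun p hp ↦ ?_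
      exact h.layerHomotopy_of_mem (h.mono'.mem_layered (i := i) ⟨_, hp.1, rfl⟩ hp.2.1) _
    have hcl1 : IsClosed {p : (Fin n → ℝ) × ℝ × ℝ | p.1 ∈ sphere 0 1 ∧ (map n i p.1, p.2) ∈
        {p : X × ℝ × ℝ | (p.1, p.2.1) ∈ layered κ ∧ p.2.2 ∈ Icc (0 : ℝ) 1}} := by
      convert (isClosed_preimage_map_prod i hS).inter
        (isClosed_sphere.preimage (continuous_fst (X := Fin n → ℝ) (Y := ℝ × ℝ))) using 1
      ext p
      constructor
      · exact fun hp ↦ ⟨⟨sphere_subset_closedBall hp.1, hp.2⟩, hp.1⟩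
      · exact fun hp ↦ ⟨hp.2, hp.1.2⟩
    have hcl2 : IsClosed (closedBall (0 : Fin n → ℝ) 1 ×ˢ κ' n i ×ˢ (univ : Set ℝ)) :=
      isClosed_closedBall.prod ((h.isClosed' n i).prod isClosed_univ)
    refine (hfr.union_of_isClosed hcyl hcl1 hcl2).mono fun p hp ↦ ?_
    have hb := hp.1
    rw [← sphere_union_ball] at hb
    rcases hb with hb | hb
    · exact Or.inl ⟨hb, hp.2⟩
    · refine Or.inr ⟨hp.1, ?_, mem_univ _⟩
      rw [h.eq_of_ne n hn.ne']
      exact (mem_layered_iff (i := i) ⟨_, hb, rfl⟩).1 hp.2.1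

/-- A collapse is a deformation retract. -/
theorem exists_homotopyEquiv [T2Space X] (h : IsCollapse κ κ' d π) :
    ∃ e : ContinuousMap.HomotopyEquiv (layered κ) (layered κ'), Function.Surjective e := by
  have hc := h.continuousOn_layerHomotopy
  let H : C(unitInterval × layered κ, layered κ) :=
    ⟨fun q ↦ ⟨layerHomotopy d π (q.2.1.1, q.2.1.2, q.1), h.layerHomotopy_mem q.2.2 q.1.2⟩,
      (hc.comp_continuous (by fun_prop) fun q ↦ ⟨q.2.2, q.1.2⟩).subtype_mk _⟩
  let r : C(layered κ, layered κ') :=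
    ⟨fun q ↦ ⟨layerHomotopy d π (q.1.1, q.1.2, 1), h.layerHomotopy_one_mem q.2⟩,
      (hc.comp_continuous (by fun_prop) fun q ↦ ⟨q.2, by simp⟩).subtype_mk _⟩
  let ι : C(layered κ', layered κ) := ⟨inclusion h.subset, continuous_inclusion h.subset⟩
  have hr : r.comp ι = ContinuousMap.id _ := by
    ext q : 2
    exact h.layerHomotopy_of_mem q.2 1
  -- Surjectivity of `r` follows from `r ∘ ι = id`; it later carries connectedness to the telescope.
  refine ⟨⟨r, ι, ⟨ContinuousMap.Homotopy.symm ⟨H, fun q ↦ ?_, fun q ↦ ?_⟩⟩, hr ▸ .refl _⟩, fun q ↦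
    ⟨ι q, DFunLike.congr_fun hr q⟩⟩
  · exact Subtype.ext (layerHomotopy_zero _ _)
  · rfl

end IsCollapse

end Layers

/-! ### The unit ball of the sup norm as a product. -/

section UnitCube

variable {n : ℕ} {b : Fin (n + 1) → ℝ}

/-- In the sup norm the ball is a cube, so splitting off coordinate 0 makes it the product of an
interval and a lower ball: the domain needed for a cell times an interval. -/
lemma mem_closedBall_pi_succ :
    b ∈ closedBall 0 1 ↔ b 0 ∈ Icc (-1 : ℝ) 1 ∧ Fin.tail b ∈ closedBall 0 1 := by
  simp only [mem_closedBall_zero_iff, pi_norm_le_iff_of_nonneg zero_le_one, Fin.forall_fin_succ,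
    Fin.tail, Real.norm_eq_abs, mem_Icc, abs_le]

lemma mem_ball_pi_succ :
    b ∈ ball 0 1 ↔ b 0 ∈ Ioo (-1 : ℝ) 1 ∧ Fin.tail b ∈ ball 0 1 := by
  simp only [mem_ball_zero_iff, pi_norm_lt_iff one_pos, Fin.forall_fin_succ,
    Fin.tail, Real.norm_eq_abs, mem_Ioo, abs_lt]

lemma mem_sphere_pi_succ (hb : b ∈ sphere 0 1) :
    b ∈ closedBall 0 1 ∧ (b 0 = -1 ∨ b 0 = 1 ∨ Fin.tail b ∈ sphere 0 1) := by
  have h1 := sphere_subset_closedBall hb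
  refine ⟨h1, ?_⟩
  by_contra! h
  have h2 := mem_closedBall_pi_succ.1 h1
  have h3 : b ∈ ball 0 1 := mem_ball_pi_succ.2
    ⟨⟨lt_of_le_of_ne h2.1.1 h.1.symm, lt_of_le_of_ne h2.1.2 h.2.1⟩,
      by
        have := h2.2
        rw [← sphere_union_ball] at this
        exact this.resolve_left h.2.2⟩
  exact disjoint_left.1 sphere_disjoint_ball hb h3

end UnitCube

/-! ### The product cell structure on `X × ℝ`. -/

section Cylinder

variable (X : Type u) [TopologicalSpace X] [CWComplex (univ : Set X)]

/-- The cells of the cylinder `X × ℝ`: the slices of cells at integer heights, and the products of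
cells with intervals between consecutive integers. -/
inductive CylCell : ℕ → Type u
  | slice {n : ℕ} (i : cell (univ : Set X) n) (k : ℤ) : CylCell n
  | slab {n : ℕ} (i : cell (univ : Set X) n) (k : ℤ) : CylCell (n + 1)

variable {X}

namespace CylCell

/-- The dimension of the cell of `X` below a cell of the cylinder. -/
def baseDim : ∀ {n : ℕ}, CylCell X n → ℕ
  | n, slice _ _ => n
  | _, slab (n := n) _ _ => n

/-- The cell of `X` below a cell of the cylinder. -/
def base : ∀ {n : ℕ} (c : CylCell X n), cell (univ : Set X) c.baseDim
  | _, slice i _ => i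
  | _, slab i _ => i

/-- The heights of an open cell of the cylinder. -/
def openHeights : ∀ {n : ℕ}, CylCell X n → Set ℝ
  | _, slice _ k => {(k : ℝ)}
  | _, slab _ k => Ioo (k : ℝ) (k + 1)

/-- The heights of a closed cell of the cylinder. -/
def closedHeights : ∀ {n : ℕ}, CylCell X n → Set ℝ
  | _, slice _ k => {(k : ℝ)}
  | _, slab _ k => Icc (k : ℝ) (k + 1)

/-- The characteristic map of a slice. -/
@[simps]
noncomputable def sliceMap {n : ℕ} (i : cell (univ : Set X) n) (k : ℤ) :
    PartialEquiv (Fin n → ℝ) (X × ℝ) where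
  toFun b := (map n i b, k)
  invFun p := (map n i).symm p.1
  source := ball 0 1
  target := openCell n i ×ˢ {(k : ℝ)}
  map_source' b hb := ⟨⟨b, hb, rfl⟩, rfl⟩
  map_target' := by
    rintro ⟨x, t⟩ ⟨⟨b, hb, rfl⟩, -⟩
    simpa only [(map n i).left_inv ((source_eq n i).symm ▸ hb)] using hb
  left_inv' b hb := (map n i).left_inv ((source_eq n i).symm ▸ hb)
  right_inv' := by
    rintro ⟨x, t⟩ ⟨⟨b, hb, rfl⟩, ht⟩
    simp only [(map n i).left_inv ((source_eq n i).symm ▸ hb)]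
    exact Prod.ext rfl (mem_singleton_iff.1 ht).symm

/-- The characteristic map of a slab. -/
@[simps]
noncomputable def slabMap {n : ℕ} (i : cell (univ : Set X) n) (k : ℤ) :
    PartialEquiv (Fin (n + 1) → ℝ) (X × ℝ) where
  -- Coordinate 0 is rescaled affinely from `[-1, 1]` to `[k, k + 1]`.
  toFun b := (map n i (Fin.tail b), k + (b 0 + 1) / 2)
  invFun p := Fin.cons (2 * (p.2 - k) - 1) ((map n i).symm p.1)
  source := ball 0 1
  target := openCell n i ×ˢ Ioo (k : ℝ) (k + 1)
  map_source' b hb := by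
    obtain ⟨⟨h1, h2⟩, h3⟩ := mem_ball_pi_succ.1 hb
    exact ⟨⟨_, h3, rfl⟩, by constructor <;> simp only <;> linarith⟩
  map_target' := by
    rintro ⟨x, t⟩ ⟨⟨b, hb, rfl⟩, h1, h2⟩
    simp only at h1 h2
    rw [mem_ball_pi_succ, Fin.tail_cons, Fin.cons_zero,
      (map n i).left_inv ((source_eq n i).symm ▸ hb)]
    exact ⟨by constructor <;> linarith, hb⟩
  left_inv' b hb := by
    rw [(map n i).left_inv ((source_eq n i).symm ▸ (mem_ball_pi_succ.1 hb).2)]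
    convert Fin.cons_self_tail b using 2
    ring
  right_inv' := by
    rintro ⟨x, t⟩ ⟨⟨b, hb, rfl⟩, -⟩
    simp only [Fin.tail_cons, Fin.cons_zero, (map n i).left_inv ((source_eq n i).symm ▸ hb)]
    congr 1
    ring

/-- The characteristic maps of the cylinder. -/
noncomputable def charMap : ∀ {n : ℕ}, CylCell X n → PartialEquiv (Fin n → ℝ) (X × ℝ)
  | _, slice i k => sliceMap i k
  | _, slab i k => slabMap i k

lemma image_ball : ∀ {n : ℕ} (c : CylCell X n),
    c.charMap '' ball 0 1 = openCell c.baseDim c.base ×ˢ c.openHeights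
  | _, slice i k => (sliceMap i k).image_source_eq_target
  | _, slab i k => (slabMap i k).image_source_eq_target

lemma image_closedBall : ∀ {n : ℕ} (c : CylCell X n),
    c.charMap '' closedBall 0 1 = closedCell c.baseDim c.base ×ˢ c.closedHeights
  | _, slice i k => by
    ext ⟨x, t⟩
    constructor
    · rintro ⟨b, hb, h⟩
      obtain ⟨rfl, rfl⟩ := Prod.mk.inj h
      exact ⟨⟨b, hb, rfl⟩, rfl⟩
    · rintro ⟨⟨b, hb, rfl⟩, ht⟩
      exact ⟨b, hb, Prod.ext rfl (mem_singleton_iff.1 ht).symm⟩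
  | _, slab (n := n) i k => by
    ext ⟨x, t⟩
    constructor
    · rintro ⟨b, hb, h⟩
      obtain ⟨rfl, rfl⟩ := Prod.mk.inj h
      obtain ⟨⟨h1, h2⟩, h3⟩ := mem_closedBall_pi_succ.1 hb
      exact ⟨⟨_, h3, rfl⟩, by constructor <;> simp only <;> linarith⟩
    · rintro ⟨⟨b, hb, rfl⟩, h1, h2⟩
      change Fin n → ℝ at b
      simp only at h1 h2
      refine ⟨Fin.cons (2 * (t - k) - 1) b, mem_closedBall_pi_succ.2 ⟨?_, ?_⟩, ?_⟩
      · rw [Fin.cons_zero]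
        constructor <;> linarith
      · rwa [Fin.tail_cons]
      · simp only [charMap, slabMap_apply, Fin.tail_cons, Fin.cons_zero]
        refine Prod.ext rfl ?_
        simp only
        ring

lemma continuousOn_charMap : ∀ {n : ℕ} (c : CylCell X n), ContinuousOn c.charMap (closedBall 0 1)
  | n, slice i k => (continuousOn n i).prodMk continuousOn_const
  | _, slab (n := n) i k =>
    ((continuousOn n i).comp (t := closedBall 0 1)
      (by unfold Fin.tail; fun_prop : Continuous (Fin.tail (α := fun _ ↦ ℝ))).continuousOn
      fun _ hb ↦ (mem_closedBall_pi_succ.1 hb).2).prodMk (by fun_prop)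

lemma target_eq_openCell {n : ℕ} (i : cell (univ : Set X) n) : (map n i).target = openCell n i := by
  rw [openCell, ← source_eq n i, (map n i).image_source_eq_target]

lemma continuousOn_charMap_symm : ∀ {n : ℕ} (c : CylCell X n),
    ContinuousOn c.charMap.symm c.charMap.target
  | n, slice i k => by
    refine (continuousOn_symm n i).comp continuousOn_fst fun p hp ↦ ?_
    rw [target_eq_openCell]
    exact hp.1
  | _, slab (n := n) i k => by
    have h : ContinuousOn (fun p : X × ℝ ↦ (map n i).symm p.1) (slabMap i k).target := by
      refine (continuousOn_symm n i).comp continuousOn_fst fun p hp ↦ ?_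
      rw [target_eq_openCell]
      exact hp.1
    refine continuousOn_pi.2 (Fin.cases ?_ fun j ↦ ?_)
    · change ContinuousOn (fun p : X × ℝ ↦ 2 * (p.2 - k) - 1) _
      fun_prop
    · exact continuousOn_pi.1 h j

lemma sigma_eq {n m : ℕ} (c : CylCell X n) (c' : CylCell X m) {p : X × ℝ}
    (hc : p ∈ c.charMap '' ball 0 1) (hc' : p ∈ c'.charMap '' ball 0 1) :
    (⟨n, c⟩ : Σ n, CylCell X n) = ⟨m, c'⟩ := by
  rw [image_ball] at hc hc'
  have hb := sigma_eq_of_mem_openCell hc.1 hc'.1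
  have h1 := hc.2
  have h2 := hc'.2
  cases c with
  | slice i k =>
    cases c' with
    | slice j l =>
      cases hb
      have : (k : ℝ) = l := (mem_singleton_iff.1 h1).symm.trans (mem_singleton_iff.1 h2)
      rw [Int.cast_inj.1 this]
    | slab j l =>
      simp only [openHeights, mem_singleton_iff, mem_Ioo] at h1 h2
      rw [h1] at h2
      norm_cast at h2
      omega
  | slab i k =>
    cases c' with
    | slice j l =>
      simp only [openHeights, mem_singleton_iff, mem_Ioo] at h1 h2
      rw [h2] at h1
      norm_cast at h1
      omega
    | slab j l =>
      cases hb
      simp only [openHeights, mem_Ioo] at h1 h2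
      have h3 : (k : ℝ) < l + 1 := h1.1.trans h2.2
      have h4 : (l : ℝ) < k + 1 := h2.1.trans h1.2
      norm_cast at h3 h4
      rw [show k = l by omega]

/-- The boundary of a slab consists of its bottom and top slices, at heights `k` and `k + 1`, and of
walls covered by the slabs over finitely many lower cells of `X`. A slice has the boundary of its
base cell. -/
lemma exists_finset_mapsTo_sphere {n : ℕ} (c : CylCell X n) :
    ∃ I : Π m, Finset (CylCell X m), MapsTo c.charMap (sphere 0 1)
      (⋃ (m < n) (j ∈ I m), j.charMap '' closedBall 0 1) := by
  suffices ∃ F : Set (Σ m, CylCell X m), F.Finite ∧ ∀ b ∈ sphere 0 1, ∃ j ∈ F, j.1 < n ∧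
      c.charMap b ∈ closedCell j.2.baseDim j.2.base ×ˢ j.2.closedHeights by
    obtain ⟨F, hF, h⟩ := this
    refine ⟨fun m ↦ (hF.preimage (f := Sigma.mk m) sigma_mk_injective.injOn).toFinset,
      fun b hb ↦ ?_⟩
    obtain ⟨⟨m, j⟩, hj, hm, h⟩ := h b hb
    simp only [mem_iUnion]
    exact ⟨m, hm, j, by simpa using hj, by rwa [image_closedBall]⟩
  cases c with
  | slice i k =>
    obtain ⟨J, hJ⟩ := CWComplex.mapsTo n i
    refine ⟨⋃ m ∈ Finset.range n, (fun j ↦ ⟨m, slice j k⟩) '' (J m : Set (cell (univ : Set X) m)),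
      Set.Finite.biUnion (Finset.finite_toSet _) fun m _ ↦ (Finset.finite_toSet _).image _,
      fun b hb ↦ ?_⟩
    have := hJ hb
    simp only [mem_iUnion] at this
    obtain ⟨m, hm, j, hj, h⟩ := this
    refine ⟨⟨m, slice j k⟩, ?_, hm, h, rfl⟩
    simp only [mem_iUnion]
    exact ⟨m, Finset.mem_range.2 hm, j, hj, rfl⟩
  | @slab n i k =>
    obtain ⟨J, hJ⟩ := CWComplex.mapsTo n i
    refine ⟨{⟨n, slice i k⟩, ⟨n, slice i (k + 1)⟩} ∪
      ⋃ m ∈ Finset.range n, (fun j ↦ ⟨m + 1, slab j k⟩) '' (J m : Set (cell (univ : Set X) m)),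
      Set.Finite.union (by simp) (Set.Finite.biUnion (Finset.finite_toSet _)
        fun m _ ↦ (Finset.finite_toSet _).image _), fun b hb ↦ ?_⟩
    obtain ⟨h1, h2⟩ := mem_sphere_pi_succ hb
    obtain ⟨h3, h4⟩ := mem_closedBall_pi_succ.1 h1
    rcases h2 with h2 | h2 | h2
    · refine ⟨⟨n, slice i k⟩, by simp, n.lt_succ_self, ⟨_, h4, rfl⟩, ?_⟩
      simp [closedHeights, charMap, h2]
    · refine ⟨⟨n, slice i (k + 1)⟩, by simp, n.lt_succ_self, ⟨_, h4, rfl⟩, ?_⟩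
      simp [closedHeights, charMap, h2]
    · have := hJ h2
      simp only [mem_iUnion] at this
      obtain ⟨m, hm, j, hj, h⟩ := this
      refine ⟨⟨m + 1, slab j k⟩, Or.inr ?_, Nat.succ_lt_succ hm, h, ?_⟩
      · simp only [mem_iUnion]
        exact ⟨m, Finset.mem_range.2 hm, j, hj, rfl⟩
      · simp only [closedHeights, charMap, slabMap_apply, mem_Icc]
        constructor <;> linarith [h3.1, h3.2]

lemma exists_mem_openHeights (t : ℝ) {n : ℕ} (i : cell (univ : Set X) n) :
    ∃ m, ∃ c : CylCell X m, t ∈ c.openHeights ∧ ∃ h : c.baseDim = n, h ▸ c.base = i := by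
  by_cases h : (⌊t⌋ : ℝ) = t
  · exact ⟨n, slice i ⌊t⌋, h.symm, rfl, rfl⟩
  · exact ⟨n + 1, slab i ⌊t⌋, ⟨lt_of_le_of_ne (Int.floor_le t) h, Int.lt_floor_add_one t⟩, rfl, rfl⟩

lemma openHeights_subset_closedHeights : ∀ {n : ℕ} (c : CylCell X n),
    c.openHeights ⊆ c.closedHeights
  | _, slice _ _ => subset_rfl
  | _, slab _ _ => Ioo_subset_Icc_self

lemma exists_mem_image_ball (p : X × ℝ) {n : ℕ} {i : cell (univ : Set X) n}
    (hp : p.1 ∈ openCell n i) :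
    ∃ m, ∃ c : CylCell X m, p ∈ c.charMap '' ball 0 1 := by
  obtain ⟨m, c, hc, rfl, rfl⟩ := exists_mem_openHeights p.2 i
  exact ⟨m, c, by rw [image_ball]; exact ⟨hp, hc⟩⟩

/-- Over one closed cell of `X`, `A` is the union of its pieces in the slabs; these are closed and
locally finite because the intervals `[k, k + 1]` are. -/
lemma isClosed_of_isClosed_inter_image [T2Space X] (A : Set (X × ℝ))
    (hA : ∀ n (c : CylCell X n), IsClosed (A ∩ c.charMap '' closedBall 0 1)) : IsClosed A := by
  refine isClosed_of_isClosed_inter_closedCell_prod fun n i ↦ ?_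
  have : A ∩ closedCell n i ×ˢ (univ : Set ℝ) =
      ⋃ k : ℤ, A ∩ (slab i k).charMap '' closedBall 0 1 := by
    ext p
    simp only [image_closedBall, mem_inter_iff, mem_iUnion, mem_prod, mem_univ, and_true]
    constructor
    · rintro ⟨h1, h2⟩
      exact ⟨⌊p.2⌋, h1, h2, Int.floor_le p.2, (Int.lt_floor_add_one p.2).le⟩
    · rintro ⟨k, h1, h2, -⟩
      exact ⟨h1, h2⟩
  rw [this]
  refine LocallyFinite.isClosed_iUnion ?_ fun k ↦ hA _ _
  have hf : LocallyFinite fun k : ℤ ↦ Icc (k : ℝ) (k + 1) := by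
    intro t
    refine ⟨Ioo (t - 1) (t + 1), Ioo_mem_nhds (by linarith) (by linarith),
      (finite_Icc (⌊t⌋ - 2) (⌊t⌋ + 2)).subset ?_⟩
    rintro k ⟨s, ⟨h1, h2⟩, h3, h4⟩
    have h5 := Int.floor_le t
    have h6 := Int.lt_floor_add_one t
    have h7 : (k : ℝ) < ⌊t⌋ + 2 := by linarith
    have h8 : (⌊t⌋ : ℝ) < k + 2 := by linarith
    norm_cast at h7 h8
    exact ⟨by omega, by omega⟩
  refine (hf.preimage_continuous (continuous_snd (X := X))).subset fun k p hp ↦ ?_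
  rw [image_closedBall] at hp
  exact hp.2.2

end CylCell

/-- The product CW structure on the cylinder `X × ℝ`. -/
@[reducible]
noncomputable def cylinderCWComplex (X : Type u) [TopologicalSpace X] [T2Space X]
    [CWComplex (univ : Set X)] : CWComplex (univ : Set (X × ℝ)) where
  cell := CylCell X
  map _ c := c.charMap
  source_eq _ c := by cases c <;> rfl
  continuousOn _ c := c.continuousOn_charMap
  continuousOn_symm _ c := c.continuousOn_charMap_symm
  pairwiseDisjoint' := by
    rintro ⟨n, c⟩ - ⟨m, c'⟩ - hne
    refine disjoint_left.2 fun p hp hp' ↦ hne (CylCell.sigma_eq c c' hp hp')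
  mapsTo' _ c := c.exists_finset_mapsTo_sphere
  closed' A _ hA := CylCell.isClosed_of_isClosed_inter_image A hA
  union' := by
    refine eq_univ_of_forall fun p ↦ ?_
    obtain ⟨n, i, hi⟩ := exists_mem_openCell p.1
    obtain ⟨m, c, hc⟩ := CylCell.exists_mem_image_ball p hi
    simp only [mem_iUnion]
    exact ⟨m, c, image_mono ball_subset_closedBall hc⟩

end Cylinder

/-! ### A complex in an ambient space as a complex on its own. -/

section Subspace

variable {Z : Type u} [TopologicalSpace Z]

open Classical in
/-- A characteristic map of a CW complex `E ⊆ Z`, as a map into the subspace `E`. -/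
noncomputable def subspaceMap (E : Set Z) [CWComplex E] {n : ℕ} (i : cell E n) :
    PartialEquiv (Fin n → ℝ) E where
  -- Outside the closed ball the characteristic map may leave `E`; the centre of the cell serves as
  -- a default value there.
  toFun b := if h : map n i b ∈ E then ⟨map n i b, h⟩ else
    ⟨map n i 0, closedCell_subset_complex n i (map_zero_mem_closedCell n i)⟩
  invFun y := (map n i).symm y
  source := ball 0 1
  target := Subtype.val ⁻¹' (map n i).target
  map_source' b hb := by
    have h : map n i b ∈ E := openCell_subset_complex n i ⟨b, hb, rfl⟩
    rw [dif_pos h]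
    exact (map n i).map_source (by rwa [source_eq])
  map_target' y hy := by
    rw [← source_eq n i]
    exact (map n i).map_target hy
  left_inv' b hb := by
    have h : map n i b ∈ E := openCell_subset_complex n i ⟨b, hb, rfl⟩
    rw [dif_pos h]
    exact (map n i).left_inv (by rwa [source_eq])
  right_inv' y hy := by
    have hy' := (map n i).right_inv hy
    have h : map n i ((map n i).symm y) ∈ E := by rw [hy']; exact y.2
    rw [dif_pos h]
    exact Subtype.ext hy'

variable {E : Set Z} [CWComplex E] {n : ℕ} (i : cell E n)

lemma coe_subspaceMap {b : Fin n → ℝ} (hb : b ∈ closedBall 0 1) :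
    (subspaceMap E i b : Z) = map n i b := by
  have h : map n i b ∈ E := closedCell_subset_complex n i ⟨b, hb, rfl⟩
  exact congrArg Subtype.val (dif_pos h)

lemma coe_image_subspaceMap {s : Set (Fin n → ℝ)} (hs : s ⊆ closedBall 0 1) :
    Subtype.val '' (subspaceMap E i '' s) = map n i '' s := by
  rw [image_image]
  exact image_congr fun b hb ↦ coe_subspaceMap i (hs hb)

lemma mem_image_subspaceMap {s : Set (Fin n → ℝ)} (hs : s ⊆ closedBall 0 1) {y : E} :
    y ∈ subspaceMap E i '' s ↔ (y : Z) ∈ map n i '' s := by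
  rw [← coe_image_subspaceMap i hs, Subtype.val_injective.mem_set_image]

/-- A CW complex in an ambient space is a CW complex in its own right. -/
@[reducible]
noncomputable def subspaceCWComplex [T2Space Z] (E : Set Z) [CWComplex E] :
    CWComplex (univ : Set E) where
  cell := cell E
  map _ i := subspaceMap E i
  source_eq _ _ := rfl
  continuousOn n i := by
    rw [Topology.IsInducing.subtypeVal.continuousOn_iff]
    exact (continuousOn n i).congr fun b hb ↦ coe_subspaceMap i hb
  continuousOn_symm n i := (continuousOn_symm n i).comp continuous_subtype_val.continuousOn fun _ hy ↦ hy
  pairwiseDisjoint' := by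
    rintro ⟨n, i⟩ - ⟨m, j⟩ - hne
    refine disjoint_left.2 fun p hp hp' ↦ ?_
    rw [mem_image_subspaceMap _ ball_subset_closedBall] at hp hp'
    exact disjoint_left.1 (disjoint_openCell_of_ne hne) hp hp'
  mapsTo' n i := by
    obtain ⟨I, hI⟩ := CWComplex.mapsTo n i
    refine ⟨I, fun b hb ↦ ?_⟩
    have := hI hb
    simp only [mem_iUnion] at this ⊢
    obtain ⟨m, hm, j, hj, h⟩ := this
    refine ⟨m, hm, j, hj, ?_⟩
    rwa [mem_image_subspaceMap _ subset_rfl, coe_subspaceMap i (sphere_subset_closedBall hb)]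
  closed' A _ hA := by
    have hemb : IsClosedEmbedding (Subtype.val : E → Z) :=
      (CWComplex.isClosed (C := E)).isClosedEmbedding_subtypeVal
    rw [hemb.isClosed_iff_image_isClosed, CWComplex.closed E _ (Subtype.coe_image_subset E A)]
    intro n i
    have := hemb.isClosed_iff_image_isClosed.1 (hA n i)
    rwa [image_inter Subtype.val_injective, coe_image_subspaceMap i subset_rfl] at this
  union' := by
    refine eq_univ_of_forall fun y ↦ ?_
    have hy : (y : Z) ∈ ⋃ (n : ℕ) (j : cell E n), closedCell n j := by
      rw [CWComplex.union]
      exact y.2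
    simp only [mem_iUnion] at hy ⊢
    obtain ⟨n, i, h⟩ := hy
    exact ⟨n, i, (mem_image_subspaceMap i subset_rfl).2 h⟩

end Subspace

/-! ### Layered sets as subcomplexes of the cylinder. -/

section Layered

variable {X : Type u} [TopologicalSpace X] [CWComplex (univ : Set X)]
  {κ : ∀ n, cell (univ : Set X) n → Set ℝ}

/-- A choice of heights is integral if each of its members is a union of integers and of closed
intervals between consecutive integers. -/
def IntegralHeights (κ : ∀ n, cell (univ : Set X) n → Set ℝ) : Prop :=
  ∀ ⦃n⦄ (i : cell (univ : Set X) n) ⦃k : ℤ⦄ ⦃t : ℝ⦄,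
    t ∈ κ n i → t ∈ Ioo (k : ℝ) (k + 1) → Icc (k : ℝ) (k + 1) ⊆ κ n i

/-- An open cell of the cylinder with one point in the layered set belongs to it together with all
its closed heights, so the layered set is a union of cells. -/
lemma IntegralHeights.closedHeights_subset (hκ : IntegralHeights κ) {t : ℝ} :
    ∀ {n : ℕ} (c : CylCell X n), t ∈ c.openHeights → t ∈ κ c.baseDim c.base →
      c.closedHeights ⊆ κ c.baseDim c.base
  | _, .slice i k, h, h' => by
    rintro s rfl
    rwa [mem_singleton_iff.1 h] at h'
  | _, .slab i k, h, h' => hκ i h' h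

variable [T2Space X]

/-- The part of the cylinder over a cell complex given by a face monotone and integral choice of
heights, as a subcomplex. -/
noncomputable def layeredSubcomplex (hκ : FaceMonotone κ) (hκ' : IntegralHeights κ) :
    letI := cylinderCWComplex X
    CWComplex.Subcomplex (univ : Set (X × ℝ)) :=
  letI := cylinderCWComplex X
  CWComplex.Subcomplex.mk' (univ : Set (X × ℝ)) (layered κ)
    (fun n ↦ {c : CylCell X n | c.closedHeights ⊆ κ c.baseDim c.base})
    (by
      rintro n ⟨c, hc⟩ p hp
      have hp : p ∈ c.charMap '' closedBall 0 1 := hp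
      rw [CylCell.image_closedBall] at hp
      exact hκ.mem_layered hp.1 (hc hp.2))
    (by
      ext p
      simp only [mem_iUnion]
      constructor
      · rintro ⟨n, ⟨c, hc⟩, hp⟩
        have hp : p ∈ c.charMap '' ball 0 1 := hp
        rw [CylCell.image_ball] at hp
        exact ⟨_, _, hp.1, hc (c.openHeights_subset_closedHeights hp.2)⟩
      · intro hp
        obtain ⟨n, i, hi, ht⟩ := hp
        obtain ⟨m, c, hc⟩ := CylCell.exists_mem_image_ball p hi
        have hc' := hc
        rw [CylCell.image_ball] at hc'
        refine ⟨m, ⟨c, ?_⟩, hc⟩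
        exact hκ'.closedHeights_subset c hc'.2 ((mem_layered_iff hc'.1).1 ⟨n, i, hi, ht⟩))

lemma isClosed_layered (hκ : FaceMonotone κ) (hκ' : IntegralHeights κ) : IsClosed (layered κ) :=
  letI := cylinderCWComplex X
  (layeredSubcomplex hκ hκ').closed'

/-- The CW structure on the part of the cylinder given by a face monotone and integral choice of
heights. -/
@[reducible]
noncomputable def layeredCWComplex (hκ : FaceMonotone κ) (hκ' : IntegralHeights κ) :
    CWComplex (univ : Set (layered κ)) :=
  letI := cylinderCWComplex X
  letI : CWComplex (layered κ) :=
    CWComplex.Subcomplex.instCWComplex (layeredSubcomplex hκ hκ')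
  subspaceCWComplex (layered κ)

lemma layeredCWComplex_coe_map (hκ : FaceMonotone κ) (hκ' : IntegralHeights κ) {n : ℕ} :
    letI := layeredCWComplex hκ hκ'
    ∀ (c : cell (univ : Set (layered κ)) n) {b : Fin n → ℝ}, b ∈ closedBall 0 1 →
      ((map n c b : layered κ) : X × ℝ) = CylCell.charMap c.1 b := by
  let := cylinderCWComplex X
  let : CWComplex (layered κ) :=
    CWComplex.Subcomplex.instCWComplex (layeredSubcomplex hκ hκ')
  exact fun c b hb ↦ coe_subspaceMap (E := layered κ) c hb

lemma layeredCWComplex_coe_mem_image (hκ : FaceMonotone κ) (hκ' : IntegralHeights κ) {n : ℕ} :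
    letI := layeredCWComplex hκ hκ'
    ∀ (c : cell (univ : Set (layered κ)) n) {s : Set (Fin n → ℝ)}, s ⊆ closedBall 0 1 →
      ∀ {y : layered κ}, y ∈ map n c '' s ↔ (y : X × ℝ) ∈ CylCell.charMap c.1 '' s := by
  let := cylinderCWComplex X
  let : CWComplex (layered κ) :=
    CWComplex.Subcomplex.instCWComplex (layeredSubcomplex hκ hκ')
  exact fun c s hs y ↦ mem_image_subspaceMap (E := layered κ) c hs

end Layered

/-! ### The telescope and its homotopy type. -/

section Telescope

variable {X : Type u} [TopologicalSpace X] [CWComplex (univ : Set X)]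

/-- The heights of the cylinder over the `1`-skeleton with each `2`-cell attached at one level. -/
def flatHeights (ν : ∀ n, cell (univ : Set X) n → ℤ) : ∀ n, cell (univ : Set X) n → Set ℝ
  | 0, _ => univ
  | 1, _ => univ
  | _ + 2, i => {(ν _ i : ℝ)}

/-- The heights of the telescope: vertices at all heights, `1`-cells above their level, and
`2`-cells at their level only. -/
def telescopeHeights (ν : ∀ n, cell (univ : Set X) n → ℤ) : ∀ n, cell (univ : Set X) n → Set ℝ
  | 0, _ => univ
  | 1, i => Ici (ν 1 i : ℝ)
  | _ + 2, i => {(ν _ i : ℝ)}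

variable {ν : ∀ n, cell (univ : Set X) n → ℤ}

/-- Reduces face monotonicity to pairs of cells of strictly decreasing dimension. -/
lemma lt_or_eq_of_mem_closedCell [T2Space X] {n m : ℕ} {i : cell (univ : Set X) n}
    {j : cell (univ : Set X) m} {x : X} (hi : x ∈ closedCell n i) (hj : x ∈ openCell m j) :
    m < n ∨ (⟨n, i⟩ : Σ n, cell (univ : Set X) n) = ⟨m, j⟩ := by
  rw [← cellFrontier_union_openCell_eq_closedCell] at hi
  rcases hi with hi | hi
  · obtain ⟨l, hl, k, hk⟩ := exists_mem_openCell_of_mem_cellFrontier hi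
    cases sigma_eq_of_mem_openCell hk hj
    exact Or.inl hl
  · exact Or.inr (sigma_eq_of_mem_openCell hi hj)

lemma not_integral_mem_Ioo {k l : ℤ} (h : (l : ℝ) ∈ Ioo (k : ℝ) (k + 1)) : False := by
  obtain ⟨h1, h2⟩ := h
  norm_cast at h1 h2
  omega

lemma integralHeights_flatHeights : IntegralHeights (flatHeights ν)
  | 0, _, _, _, _, _ => subset_univ _
  | 1, _, _, _, _, _ => subset_univ _
  | _ + 2, i, k, t, h, h' => by
    rw [mem_singleton_iff.1 h] at h'
    exact (not_integral_mem_Ioo h').elim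

lemma integralHeights_telescopeHeights : IntegralHeights (telescopeHeights ν)
  | 0, _, _, _, _, _ => subset_univ _
  | 1, i, k, t, h, h' => by
    have h1 : (ν 1 i : ℝ) < k + 1 := lt_of_le_of_lt h h'.2
    norm_cast at h1
    have h2 : (ν 1 i : ℝ) ≤ k := by exact_mod_cast (by omega : ν 1 i ≤ k)
    exact fun s hs ↦ h2.trans hs.1
  | _ + 2, i, k, t, h, h' => by
    rw [mem_singleton_iff.1 h] at h'
    exact (not_integral_mem_Ioo h').elim

lemma faceMonotone_flatHeights [T2Space X] (hP : IsTwoComplex (univ : Set X)) :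
    FaceMonotone (flatHeights ν) := by
  intro n i m j x hi hj
  rcases lt_or_eq_of_mem_closedCell hi hj with h | h
  · match m, j with
    | 0, _ => exact subset_univ _
    | 1, _ => exact subset_univ _
    | m + 2, j => exact ((hP.isEmpty_cell n (by omega)).false i).elim
  · cases h
    rfl

lemma faceMonotone_telescopeHeights [T2Space X] (hP : IsTwoComplex (univ : Set X))
    (hν : ∀ (f : cell (univ : Set X) 2) (e : cell (univ : Set X) 1),
      (closedCell 2 f ∩ openCell 1 e).Nonempty → ν 1 e ≤ ν 2 f) :
    FaceMonotone (telescopeHeights ν) := by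
  intro n i m j x hi hj
  rcases lt_or_eq_of_mem_closedCell hi hj with h | h
  · match m, j with
    | 0, _ => exact subset_univ _
    | 1, e =>
      obtain rfl : n = 2 := by
        by_contra hn
        exact (hP.isEmpty_cell n (by omega)).false i
      rintro t rfl
      -- The only real constraint: the level of a 2-cell must be an allowed height over every 1-cell
      -- it meets.
      exact (Int.cast_le (R := ℝ)).2 (hν i e ⟨x, hi, hj⟩)
    | m + 2, j => exact ((hP.isEmpty_cell n (by omega)).false i).elim
  · cases h
    rfl

/-- The retraction of heights over `f` is constant with value `ν 2 f`, so the solid cylinder over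
`f` is pushed to one disc and its wall. -/
lemma isCollapse_flatHeights [T2Space X] (hP : IsTwoComplex (univ : Set X)) :
    IsCollapse (fun _ _ ↦ univ) (flatHeights ν) 2 (fun f _ ↦ (ν 2 f : ℝ)) where
  isClosed := by rw [layered_univ]; exact isClosed_univ
  mono _ _ _ _ _ _ _ := subset_rfl
  mono' := faceMonotone_flatHeights hP
  eq_of_ne
    | 0, _, _ => rfl
    | 1, _, _ => rfl
    | 2, h, _ => (h rfl).elim
    | n + 3, _, i => ((hP.isEmpty_cell (n + 3) (by omega)).false i).elim
  eq_univ _ := rfl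
  eq_range _ := range_const.symm
  idem _ _ := rfl
  continuous _ := continuous_const
  isClosed'
    | 0, _ => isClosed_univ
    | 1, _ => isClosed_univ
    | _ + 2, _ => isClosed_singleton

/-- Over `e` the heights retract to `[ν 1 e, ∞)` by a maximum. The inequality on levels keeps the
attached 2-cells in the fixed part. -/
lemma isCollapse_telescopeHeights [T2Space X] (hP : IsTwoComplex (univ : Set X))
    (hν : ∀ (f : cell (univ : Set X) 2) (e : cell (univ : Set X) 1),
      (closedCell 2 f ∩ openCell 1 e).Nonempty → ν 1 e ≤ ν 2 f) :
    IsCollapse (flatHeights ν) (telescopeHeights ν) 1 (fun e t ↦ max (ν 1 e : ℝ) t) where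
  isClosed := isClosed_layered (faceMonotone_flatHeights hP) integralHeights_flatHeights
  mono := faceMonotone_flatHeights hP
  mono' := faceMonotone_telescopeHeights hP hν
  eq_of_ne
    | 0, _, _ => rfl
    | 1, h, _ => (h rfl).elim
    | n + 2, _, i => rfl
  eq_univ _ := rfl
  eq_range e := by
    ext t
    exact ⟨fun h ↦ ⟨t, max_eq_right h⟩, by rintro ⟨s, rfl⟩; exact le_max_left (ν 1 e : ℝ) s⟩
  idem _ _ := by simp
  continuous _ := by fun_prop
  isClosed'
    | 0, _ => isClosed_univ
    | 1, _ => isClosed_Ici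
    | _ + 2, _ => isClosed_singleton

/-- The telescope is homotopy equivalent to the complex, and connected if the complex is. -/
theorem telescope_homotopyEquiv [T2Space X] (hP : IsTwoComplex (univ : Set X))
    (hν : ∀ (f : cell (univ : Set X) 2) (e : cell (univ : Set X) 1),
      (closedCell 2 f ∩ openCell 1 e).Nonempty → ν 1 e ≤ ν 2 f) :
    Nonempty (ContinuousMap.HomotopyEquiv (layered (telescopeHeights ν)) X) ∧
      (ConnectedSpace X → ConnectedSpace (layered (telescopeHeights ν))) := by
  obtain ⟨e₁, he₁⟩ := (isCollapse_flatHeights (ν := ν) hP).exists_homotopyEquiv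
  obtain ⟨e₂, he₂⟩ := (isCollapse_telescopeHeights hP hν).exists_homotopyEquiv
  -- The collapses start from the whole cylinder, which is equivalent to `X` since `ℝ` is
  -- contractible.
  let e₀ : layered (X := X) (fun _ _ ↦ univ) ≃ₜ X × ℝ :=
    (Homeomorph.setCongr layered_univ).trans (Homeomorph.Set.univ _)
  let e₃ : ContinuousMap.HomotopyEquiv (X × ℝ) X :=
    ((ContinuousMap.HomotopyEquiv.refl X).prodCongr
      (ContractibleSpace.hequiv ℝ Unit).some).trans (Homeomorph.prodPUnit X).toHomotopyEquiv
  refine ⟨⟨(e₁.trans e₂).symm.trans (e₀.toHomotopyEquiv.trans e₃)⟩, fun hX ↦ ?_⟩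
  have hsurj : Function.Surjective (e₂ ∘ e₁ ∘ e₀.symm) :=
    he₂.comp (he₁.comp e₀.symm.surjective)
  exact hsurj.connectedSpace (e₂.continuous.comp (e₁.continuous.comp e₀.symm.continuous))

end Telescope

/-! ### Choice of the levels. -/

section Levels

variable {X : Type u} [TopologicalSpace X] [CWComplex (univ : Set X)]

lemma mem_of_openCell_inter_subcomplex (P₀ : CWComplex.Subcomplex (univ : Set X)) {n : ℕ}
    {i : cell (univ : Set X) n} {x : X} (hx : x ∈ openCell n i) (hxP : x ∈ (P₀ : Set X)) :
    i ∈ P₀.I n := by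
  by_contra h
  exact disjoint_left.1 (CWComplex.Subcomplex.disjoint_openCell_subcomplex_of_not_mem P₀ h) hx hxP

variable [T2Space X]

/-- Levels for the telescope: they vanish on a given finite subcomplex, only finitely many
`1`-cells lie below any given level, only finitely many `2`-cells lie at any given level, and the
level of a `2`-cell is at least that of the `1`-cells it meets. -/
lemma exists_levels (hP : IsTwoComplex (univ : Set X))
    (P₀ : CWComplex.Subcomplex (univ : Set X)) (hP₀ : CWComplex.Finite (P₀ : Set X)) :
    ∃ ν : ∀ n, cell (univ : Set X) n → ℤ,
      (∀ n, ∀ i ∈ P₀.I n, ν n i = 0) ∧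
      (∀ (f : cell (univ : Set X) 2) (e : cell (univ : Set X) 1),
        (closedCell 2 f ∩ openCell 1 e).Nonempty → ν 1 e ≤ ν 2 f) ∧
      (∀ k, {e : cell (univ : Set X) 1 | ν 1 e ≤ k}.Finite) ∧
      ∀ k, {f : cell (univ : Set X) 2 | ν 2 f = k}.Finite := by
  classical
  have hfin : ∀ n, (P₀.I n).Finite := fun n ↦ hP₀.finite_cell n
  have := hP.countable_cell 1
  have := hP.countable_cell 2
  obtain ⟨c₁, hc₁⟩ := exists_injective_nat (cell (univ : Set X) 1)
  obtain ⟨c₂, hc₂⟩ := exists_injective_nat (cell (univ : Set X) 2)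
  choose I hI using fun f : cell (univ : Set X) 2 ↦ CWComplex.cellFrontier_subset_finite_openCell 2 f
  -- Off `P₀`, the injective numberings `c₁`, `c₂` bound the levels from below and so give
  -- finiteness; the sum over the 1-cells covering the frontier puts each 2-cell at or above its
  -- edges.
  let ν₁ : cell (univ : Set X) 1 → ℕ := fun e ↦ if e ∈ P₀.I 1 then 0 else c₁ e
  let ν₂ : cell (univ : Set X) 2 → ℕ := fun f ↦
    if f ∈ P₀.I 2 then 0 else c₂ f + ∑ e ∈ I f 1, ν₁ e
  let ν : ∀ n, cell (univ : Set X) n → ℤ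
    | 0, _ => 0
    | 1, e => ν₁ e
    | 2, f => ν₂ f
    | _ + 3, _ => 0
  refine ⟨ν, ?_, ?_, ?_, ?_⟩
  · intro n i hi
    match n, i with
    | 0, _ => rfl
    | 1, e => simp only [ν, ν₁, if_pos hi, Nat.cast_zero]
    | 2, f => simp only [ν, ν₂, if_pos hi, Nat.cast_zero]
    | _ + 3, _ => rfl
  · rintro f e ⟨x, hxf, hxe⟩
    change (ν₁ e : ℤ) ≤ ν₂ f
    norm_cast
    by_cases hf : f ∈ P₀.I 2
    · have he : e ∈ P₀.I 1 := mem_of_openCell_inter_subcomplex P₀ hxe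
        (CWComplex.Subcomplex.closedCell_subset_of_mem P₀ hf hxf)
      simp only [ν₁, if_pos he, zero_le]
    · have hx : x ∈ cellFrontier 2 f := by
        rw [← cellFrontier_union_openCell_eq_closedCell] at hxf
        refine hxf.resolve_right fun h ↦ ?_
        have := congrArg Sigma.fst (sigma_eq_of_mem_openCell h hxe)
        simp at this
      have := hI f hx
      simp only [mem_iUnion] at this
      obtain ⟨m, hm, j, hj, hxj⟩ := this
      cases sigma_eq_of_mem_openCell hxe hxj
      simp only [ν₂, if_neg hf]
      exact (Finset.single_le_sum (f := ν₁) (fun _ _ ↦ Nat.zero_le _) hj).trans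
        (Nat.le_add_left _ _)
  · intro k
    refine ((hfin 1).union ((finite_Iic k.toNat).preimage hc₁.injOn)).subset fun e he ↦ ?_
    change (ν₁ e : ℤ) ≤ k at he
    by_cases h : e ∈ P₀.I 1
    · exact Or.inl h
    · simp only [ν₁, if_neg h] at he
      exact Or.inr (show c₁ e ≤ k.toNat by omega)
  · intro k
    refine ((hfin 2).union ((finite_Iic k.toNat).preimage hc₂.injOn)).subset fun f hf ↦ ?_
    change (ν₂ f : ℤ) = k at hf
    by_cases h : f ∈ P₀.I 2
    · exact Or.inl h
    · simp only [ν₂, if_neg h] at hf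
      exact Or.inr (show c₂ f ≤ k.toNat by omega)

end Levels

/-! ### Dimension, countability and local finiteness of the telescope. -/

section LocallyFinite

variable {X : Type u} [TopologicalSpace X] [T2Space X] [CWComplex (univ : Set X)]
  {ν : ∀ n, cell (univ : Set X) n → ℤ}

lemma isTwoComplex_telescope (hP : IsTwoComplex (univ : Set X))
    (hκ : FaceMonotone (telescopeHeights ν)) :
    letI := layeredCWComplex hκ integralHeights_telescopeHeights
    IsTwoComplex (univ : Set (layered (telescopeHeights ν))) := by
  let := layeredCWComplex hκ integralHeights_telescopeHeights
  constructor
  · intro n hn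
    refine ⟨fun c ↦ ?_⟩
    obtain ⟨c, hc⟩ : {c : CylCell X n // c.closedHeights ⊆ telescopeHeights ν c.baseDim c.base} := c
    cases c with
    | slice i k => exact (hP.isEmpty_cell n hn).false i
    | @slab n i k =>
      match n, i with
      | 2, i =>
        -- A slab over a 2-cell would be 3-dimensional, but it needs both heights `k` and `k + 1`
        -- where only one is allowed.
        have h1 := mem_singleton_iff.1 (hc (left_mem_Icc.2 (by simp : (k : ℝ) ≤ k + 1)))
        have h2 := mem_singleton_iff.1 (hc (right_mem_Icc.2 (by simp : (k : ℝ) ≤ k + 1)))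
        change (k : ℝ) + 1 = _ at h2
        change (k : ℝ) = _ at h1
        linarith [h1.trans h2.symm]
      | n + 3, i => exact (hP.isEmpty_cell (n + 3) (by omega)).false i
  · intro n
    suffices Countable (CylCell X n) from
      inferInstanceAs (Countable
        {c : CylCell X n // c.closedHeights ⊆ telescopeHeights ν c.baseDim c.base})
    have := hP.countable_cell
    let g : CylCell X n → (Σ m, cell (univ : Set X) m) × ℤ × Bool
      | .slice i k => (⟨_, i⟩, k, false)
      | .slab i k => (⟨_, i⟩, k, true)
    refine Function.Injective.countable (f := g) ?_
    intro c c' h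
    cases c <;> cases c' <;> simp_all [g]

/-- A horizontal edge `e × {k}` meets only the 2-cells of level `k` and the two slabs over `e` next
to height `k`. A vertical edge `v × (k, k + 1)` meets only slabs over 1-cells of level at most `k`.
-/
lemma locallyFinite_telescope (hκ : FaceMonotone (telescopeHeights ν))
    (h₁ : ∀ k, {e : cell (univ : Set X) 1 | ν 1 e ≤ k}.Finite)
    (h₂ : ∀ k, {f : cell (univ : Set X) 2 | ν 2 f = k}.Finite) :
    letI := layeredCWComplex hκ integralHeights_telescopeHeights
    LocallyFiniteTwoComplex (univ : Set (layered (telescopeHeights ν))) := by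
  let := layeredCWComplex hκ integralHeights_telescopeHeights
  intro c
  -- It is enough to bound the 2-cells whose closed cell, rather than frontier, meets the open edge;
  -- this is checked in the cylinder.
  suffices ∃ F : Set (CylCell X 2), F.Finite ∧ ∀ c₂ : CylCell X 2,
      c₂.closedHeights ⊆ telescopeHeights ν c₂.baseDim c₂.base →
      (c₂.charMap '' closedBall 0 1 ∩ c.1.charMap '' ball 0 1).Nonempty → c₂ ∈ F by
    obtain ⟨F, hF, h⟩ := this
    refine (hF.preimage (f := Subtype.val) Subtype.val_injective.injOn).subset ?_
    rintro c₂ ⟨y, hy₂, hy⟩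
    refine h c₂.1 c₂.2 ⟨y, ?_, ?_⟩
    · exact (layeredCWComplex_coe_mem_image hκ _ c₂ subset_rfl).1
        (cellFrontier_subset_closedCell _ _ hy₂)
    · exact (layeredCWComplex_coe_mem_image hκ _ c ball_subset_closedBall).1 hy
  obtain ⟨c, -⟩ : {c : CylCell X 1 // c.closedHeights ⊆ telescopeHeights ν c.baseDim c.base} := c
  simp only [CylCell.image_ball, CylCell.image_closedBall]
  cases c with
  | slice e k =>
    refine ⟨(fun f ↦ .slice f k) '' {f | ν 2 f = k} ∪ {.slab e k, .slab e (k - 1)},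
      ((h₂ k).image _).union (by simp), ?_⟩
    rintro c₂ hc₂ ⟨⟨x, t⟩, ⟨hx₂, ht₂⟩, hx, ht⟩
    obtain rfl : t = k := ht
    cases c₂ with
    | slice f l =>
      obtain rfl : k = l := Int.cast_inj.1 (mem_singleton_iff.1 ht₂)
      have : (k : ℝ) = ν 2 f := mem_singleton_iff.1 (hc₂ rfl)
      exact Or.inl ⟨f, (Int.cast_inj.1 this).symm, rfl⟩
    | slab e' l =>
      rcases lt_or_eq_of_mem_closedCell hx₂ hx with h | h
      · exact absurd h (lt_irrefl 1)
      · cases h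
        obtain ⟨h1, h2⟩ := ht₂
        simp only at h1 h2
        norm_cast at h1 h2
        obtain rfl | rfl : l = k ∨ l = k - 1 := by omega
        · exact Or.inr (Or.inl rfl)
        · exact Or.inr (Or.inr rfl)
  | slab v k =>
    refine ⟨(fun e ↦ .slab e k) '' {e | ν 1 e ≤ k}, (h₁ k).image _, ?_⟩
    rintro c₂ hc₂ ⟨⟨x, t⟩, ⟨hx₂, ht₂⟩, hx, ht⟩
    cases c₂ with
    | slice f l =>
      obtain rfl : t = l := ht₂
      exact (not_integral_mem_Ioo ht).elim
    | slab e l =>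
      obtain ⟨h1, h2⟩ := ht₂
      obtain ⟨h3, h4⟩ := ht
      simp only at h1 h2 h3 h4
      have h5 : (l : ℝ) < k + 1 := by linarith
      have h6 : (k : ℝ) < l + 1 := by linarith
      norm_cast at h5 h6
      obtain rfl : l = k := by omega
      have : (ν 1 e : ℝ) ≤ l := hc₂ (left_mem_Icc.2 (by simp : (l : ℝ) ≤ l + 1))
      exact ⟨e, Int.cast_le.1 this, rfl⟩

end LocallyFinite

/-! ### The copy of the subcomplex at height zero. -/

section Base

variable {X : Type u} [TopologicalSpace X] [T2Space X] [CWComplex (univ : Set X)]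
  {κ : ∀ n, cell (univ : Set X) n → Set ℝ}

/-- A subcomplex over which height zero is allowed embeds into the layered complex. -/
theorem exists_subcomplex_cwIso (hκ : FaceMonotone κ) (hκ' : IntegralHeights κ)
    (P₀ : CWComplex.Subcomplex (univ : Set X)) (h₀ : ∀ n, ∀ i ∈ P₀.I n, (0 : ℝ) ∈ κ n i) :
    letI := layeredCWComplex hκ hκ'
    ∃ Q : CWComplex.Subcomplex (univ : Set (layered κ)),
      Nonempty (CWIso (P₀ : Set X) (Q : Set (layered κ))) := by
  let := layeredCWComplex hκ hκ'
  have hcell : ∀ n, ∀ i ∈ P₀.I n,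
      (CylCell.slice i 0).closedHeights ⊆ κ (CylCell.slice i 0).baseDim (CylCell.slice i 0).base := by
    rintro n i hi t rfl
    exact (Int.cast_zero (R := ℝ)).symm ▸ h₀ n i hi
  let s : ∀ n, P₀.I n → cell (univ : Set (layered κ)) n := fun n i ↦
    (⟨CylCell.slice i.1 0, hcell n i.1 i.2⟩ :
      {c : CylCell X n // c.closedHeights ⊆ κ c.baseDim c.base})
  have hs : ∀ n i, ((s n i).1 : CylCell X n) = CylCell.slice i.1 0 := fun _ _ ↦ rfl
  have hmem : ∀ x ∈ (P₀ : Set X), (x, (0 : ℝ)) ∈ layered κ := by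
    intro x hx
    obtain ⟨n, i, hi⟩ := exists_mem_openCell x
    exact ⟨n, i, hi, h₀ n i (mem_of_openCell_inter_subcomplex P₀ hi hx)⟩
  let Q : CWComplex.Subcomplex (univ : Set (layered κ)) :=
    { carrier := {y | y.1.1 ∈ (P₀ : Set X) ∧ y.1.2 = 0}
      I := fun n ↦ range (s n)
      closed' := (P₀.closed'.preimage (by fun_prop)).inter
        (isClosed_singleton.preimage (by fun_prop : Continuous fun y : layered κ ↦ y.1.2))
      union' := by
        rw [empty_union]
        ext y
        simp only [mem_iUnion]
        constructor
        · rintro ⟨n, ⟨c, ⟨i, rfl⟩⟩, hy⟩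
          have hy := (layeredCWComplex_coe_mem_image hκ hκ' (s n i) ball_subset_closedBall).1 hy
          rw [hs, CylCell.image_ball] at hy
          exact ⟨CWComplex.Subcomplex.openCell_subset_of_mem P₀ i.2 hy.1,
            (mem_singleton_iff.1 hy.2).trans Int.cast_zero⟩
        · rintro ⟨hy, hy0⟩
          obtain ⟨n, i, hi⟩ := exists_mem_openCell y.1.1
          have hiP := mem_of_openCell_inter_subcomplex P₀ hi hy
          refine ⟨n, ⟨s n ⟨i, hiP⟩, ⟨i, hiP⟩, rfl⟩, ?_⟩
          refine (layeredCWComplex_coe_mem_image hκ hκ' _ ball_subset_closedBall).2 ?_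
          rw [hs, CylCell.image_ball]
          exact ⟨hi, hy0.trans Int.cast_zero.symm⟩ }
  have hinj : ∀ n, Function.Injective (s n) := by
    intro n i j h
    have h' : CylCell.slice i.1 0 = CylCell.slice j.1 0 := congrArg Subtype.val h
    simpa [Subtype.ext_iff] using h'
  refine ⟨Q, ⟨⟨⟨⟨fun x ↦ ⟨⟨(x.1, 0), hmem x.1 x.2⟩, x.2, rfl⟩, fun y ↦ ⟨y.1.1.1, y.2.1⟩,
    fun x ↦ rfl, fun y ↦ ?_⟩, ?_, ?_⟩, fun n ↦ Equiv.ofInjective (s n) (hinj n), ?_⟩⟩⟩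
  · exact Subtype.ext (Subtype.ext (Prod.ext rfl y.2.2.symm))
  · exact Continuous.subtype_mk (Continuous.subtype_mk (by fun_prop) _) _
  · exact Continuous.subtype_mk (by fun_prop) _
  · intro n i b hb p hp
    refine Subtype.ext ?_
    refine Eq.trans ?_ (layeredCWComplex_coe_map hκ hκ' (s n i) hb).symm
    rw [hs]
    exact Prod.ext hp Int.cast_zero.symm

end Base

end TwoComplex

theorem lemma2p3 {X : Type u} [TopologicalSpace X] [T2Space X]
    [CWComplex (Set.univ : Set X)]
    (hP : TwoComplex.IsTwoComplex (Set.univ : Set X))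
    (hconn : ConnectedSpace X)
    (hinf : TwoComplex.HasInfinitelyManyCells (Set.univ : Set X))
    (P₀ : CWComplex.Subcomplex (Set.univ : Set X))
    (hP₀conn : IsConnected (P₀ : Set X))
    (hP₀fin : CWComplex.Finite (P₀ : Set X)) :
    ∃ (Y : Type u) (_ : TopologicalSpace Y) (_ : T2Space Y)
      (_ : CWComplex (Set.univ : Set Y)) (Q : CWComplex.Subcomplex (Set.univ : Set Y)),
      TwoComplex.IsTwoComplex (Set.univ : Set Y) ∧
      ConnectedSpace Y ∧
      TwoComplex.LocallyFiniteTwoComplex (Set.univ : Set Y) ∧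
      Nonempty (TwoComplex.CWIso (P₀ : Set X) (Q : Set Y)) ∧
      Nonempty (ContinuousMap.HomotopyEquiv Y X) := by
  obtain ⟨ν, hν₀, hν, hν₁, hν₂⟩ := TwoComplex.exists_levels hP P₀ hP₀fin
  have hκ := TwoComplex.faceMonotone_telescopeHeights hP hν
  have hequiv := TwoComplex.telescope_homotopyEquiv hP hν
  -- Since the levels vanish on `P₀`, height 0 is the bottom of the half-line over its 1-cells and
  -- the single height over its 2-cells.
  have h₀ : ∀ n, ∀ i ∈ P₀.I n, (0 : ℝ) ∈ TwoComplex.telescopeHeights ν n i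
    | 0, _, _ => trivial
    | 1, e, he => by simp [TwoComplex.telescopeHeights, hν₀ 1 e he]
    | n + 2, f, hf => by simp [TwoComplex.telescopeHeights, hν₀ (n + 2) f hf]
  obtain ⟨Q, hQ⟩ := TwoComplex.exists_subcomplex_cwIso hκ
    TwoComplex.integralHeights_telescopeHeights P₀ h₀
  exact ⟨TwoComplex.layered (TwoComplex.telescopeHeights ν), inferInstance, inferInstance,
    TwoComplex.layeredCWComplex hκ TwoComplex.integralHeights_telescopeHeights, Q,
    TwoComplex.isTwoComplex_telescope hP hκ, hequiv.2 hconn,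
    TwoComplex.locallyFinite_telescope hκ hν₁ hν₂, hQ, hequiv.1⟩
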